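/- **Theorem 1.5.** A *condensation* is a continuous bijection. Let $\tau$ be an infinite cardinal. A compact Hausdorff space $T$ is an *$a_\tau$-space* if for every $C\subseteq T$ with $|C|\le\tau$ the subspace $T\setminus C$ admits a condensation onto a compact Hausdorff space. A Hausdorff space $X$ is *$a_\tau$-subcompact* if for every $C\subseteq X$ with $|C|\le\tau$ the subspace $X\setminus C$ admits a condensation onto an $a_\tau$-space. It is *almost strictly $a_\tau$-subcompact* if for every $C\subseteq X$ with $|C|\le\tau$ there are a compact Hausdorff space $Y$ and a condensation $f: X\setminus C\to Y$ that extends to a continuous map $X\to Y$. For every infinite cardinal $\tau$ there is a Hausdorff space that is almost strictly $a_\tau$-subcompact but not $a_\tau$-subcompact. More precisely, there are a discrete space $D$ of cardinality $\tau^+$ and an extremally disconnected compact Hausdorff space $K$ without isolated points, of cardinality $|K|>2^{2^{\tau^+}}$, such that the topological sum $D\oplus K$ is almost strictly $a_\tau$-subcompact but not $a_\tau$-subcompact. -/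

import Mathlib

universe u

open Cardinal

/-- A condensation: a continuous bijection. Since it is surjective, a condensation from `X` to `Y`
is a condensation of `X` onto the whole space `Y`. -/
def IsCondensation {X Y : Type u} [TopologicalSpace X] [TopologicalSpace Y] (f : X → Y) : Prop :=
  Continuous f ∧ Function.Bijective f

/-- `X` is an `a_τ`-space: `X` is a compact Hausdorff space, and for every `C ⊆ X` with `|C| ≤ τ`
the subspace `X \ C` admits a condensation onto a compact Hausdorff space.
(The target of a condensation is in bijection with its source, so letting it range over the
universe of `X` loses nothing.) -/
def IsATauSpace (τ : Cardinal.{u}) (X : Type u) [TopologicalSpace X] : Prop :=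
  CompactSpace X ∧ T2Space X ∧
    ∀ C : Set X, #C ≤ τ →
      ∃ (Y : Type u) (_ : TopologicalSpace Y) (_ : CompactSpace Y) (_ : T2Space Y)
        (f : (Cᶜ : Set X) → Y), IsCondensation f

/-- `X` is `a_τ`-subcompact: for every `C ⊆ X` with `|C| ≤ τ` the subspace `X \ C` admits a
condensation onto an `a_τ`-space. -/
def IsATauSubcompact (τ : Cardinal.{u}) (X : Type u) [TopologicalSpace X] : Prop :=
  ∀ C : Set X, #C ≤ τ →
    ∃ (Y : Type u) (_ : TopologicalSpace Y) (f : (Cᶜ : Set X) → Y),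
      IsATauSpace τ Y ∧ IsCondensation f

/-- `X` is almost strictly `a_τ`-subcompact: for every `C ⊆ X` with `|C| ≤ τ` there is a
condensation `f` of the subspace `X \ C` onto a compact Hausdorff space `Y` that extends to a
continuous map `g : X → Y`. -/
def IsAlmostStrictlyATauSubcompact (τ : Cardinal.{u}) (X : Type u) [TopologicalSpace X] : Prop :=
  ∀ C : Set X, #C ≤ τ →
    ∃ (Y : Type u) (_ : TopologicalSpace Y) (_ : CompactSpace Y) (_ : T2Space Y)
      (f : (Cᶜ : Set X) → Y), IsCondensation f ∧
        ∃ g : X → Y, Continuous g ∧ ∀ x : (Cᶜ : Set X), g x = f x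

open Set Filter Topology Function

/-! Suppose `D ⊕ K` condenses onto an `a_τ`-space `Y`, by `a` on `D` and `b` on `K`. In a nonempty
open `V ⊆ K` pick a sequence `c` separated by disjoint open sets, delete `b '' range c` from `Y`,
and let `g` condense the rest onto a compact `Z`. As `K` is extremally disconnected without isolated
points, `g ∘ b` extends to `h : K → Z`. By `IsSeparatedFamily.finite_mem_image`, almost all `h (c
n)` avoid the image of the undeleted part of `K`, so they are hit from `D`. By
`IsSeparatedFamily.exists_infinite_clustering`, the infinitely many points of `D` so used cluster
only in `b '' closure V`. Disjoint open sets have disjoint closures, so disjoint `V`s use different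
subsets of `D`; a `K` with more than `2 ^ #D` disjoint open sets is impossible.

For the positive half, `#D > τ` leaves enough points of `D` to fill the holes made in `K`; the
unused points are compactified by one point of `K`. -/

/-- In a compact Hausdorff space, an infinite set contains a sequence of points that can be
separated by pairwise disjoint open sets. -/
theorem Set.Infinite.exists_seq_separated {Z : Type*} [TopologicalSpace Z] [CompactSpace Z]
    [T2Space Z] {S : Set Z} (hS : S.Infinite) :
    ∃ (z : ℕ → Z) (U : ℕ → Set Z), (∀ n, z n ∈ S) ∧ (∀ n, z n ∈ U n) ∧ (∀ n, IsOpen (U n)) ∧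
      Pairwise (Disjoint on U) := by
  obtain ⟨x, hx⟩ := hS.exists_accPt_principal
  -- Keeping each `(U n)ᶜ` a neighbourhood of the accumulation point `x` leaves room for the next
  -- choice.
  suffices ∃ U : ℕ → Set Z, (∀ n, (U n ∩ S).Nonempty ∧ IsOpen (U n) ∧ (U n)ᶜ ∈ 𝓝 x) ∧
      Pairwise (Disjoint on U) by
    obtain ⟨U, hU, hd⟩ := this
    choose z hz using fun n => (hU n).1
    exact ⟨z, U, fun n => (hz n).2, fun n => (hz n).1, fun n => (hU n).2.1, hd⟩
  have : Std.Symm (α := Set Z) Disjoint := ⟨fun _ _ h ↦ h.symm⟩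
  refine exists_seq_of_forall_finset_exists' (fun U : Set Z ↦ (U ∩ S).Nonempty ∧ IsOpen U ∧
    Uᶜ ∈ 𝓝 x) Disjoint fun T hT ↦ ?_
  have hN : (⋂ U ∈ T, interior (Uᶜ)) ∈ 𝓝 x :=
    (biInter_finset_mem _).2 fun U hU ↦ interior_mem_nhds.2 (hT _ hU).2.2
  obtain ⟨y, ⟨hyU, hyS⟩, hyx⟩ := accPt_iff_nhds.1 hx _ hN
  obtain ⟨V, W, hVo, hWo, hyV, hxW, hVW⟩ := t2_separation hyx
  refine ⟨V ∩ ⋂ U ∈ T, interior (Uᶜ), ⟨⟨y, ⟨hyV, hyU⟩, hyS⟩, ?_, ?_⟩, fun U hU ↦ ?_⟩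
  · exact hVo.inter (isOpen_biInter_finset fun _ _ ↦ isOpen_interior)
  · refine mem_of_superset (hWo.mem_nhds hxW) fun z hzW ⟨hzV, _⟩ ↦ ?_
    exact disjoint_left.1 hVW hzV hzW
  · exact disjoint_left.2 fun z hzU ⟨_, hzU'⟩ ↦ interior_subset (mem_iInter₂.1 hzU' U hU) hzU

/-- There are uncountably many free ultrafilters on `ℕ`. -/
theorem exists_injective_real_freeUltrafilter :
    ∃ F : ℝ → Ultrafilter ℕ, Injective F ∧ ∀ x, (F x : Filter ℕ) ≤ cofinite := by
  -- Each real `x` gets an ultrafilter of rationals other than `x` converging to `x`: the limit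
  -- recovers `x`, and avoiding `x` makes it free.
  let e : ℕ ≃ ℚ := (Denumerable.eqv ℚ).symm
  let i : ℕ → ℝ := fun n => (e n : ℝ)
  have hi : Injective i := Rat.cast_injective.comp e.injective
  have hd : DenseRange i := Rat.isDenseEmbedding_coe_real.dense.comp e.surjective.denseRange
    Rat.continuous_coe_real
  have hne : ∀ x : ℝ, (comap i (𝓝[≠] x)).NeBot := fun x => by
    rw [comap_neBot_iff_frequently]
    have h : ∃ᶠ y in 𝓝[≠] x, y ∈ range i := by
      rw [frequently_iff]
      intro U hU
      obtain ⟨V, hV, hxV, hVU⟩ := mem_nhdsWithin.1 hU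
      have ho : IsOpen (V ∩ {x}ᶜ) := hV.inter isOpen_compl_singleton
      have hn : (V ∩ {x}ᶜ).Nonempty :=
        (NeBot.nonempty_of_mem (f := 𝓝[≠] x) inferInstance
          (inter_mem (mem_nhdsWithin_of_mem_nhds (hV.mem_nhds hxV)) self_mem_nhdsWithin))
      obtain ⟨n, hn⟩ := hd.exists_mem_open ho hn
      exact ⟨_, hVU hn, mem_range_self n⟩
    exact h
  have hle : ∀ x, ((Ultrafilter.of (comap i (𝓝[≠] x)) : Ultrafilter ℕ) : Filter ℕ)
      ≤ comap i (𝓝[≠] x) := fun x => Ultrafilter.of_le _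
  refine ⟨fun x => Ultrafilter.of (comap i (𝓝[≠] x)), fun x y hxy => ?_, fun x => ?_⟩
  · have h1 : Tendsto i (Ultrafilter.of (comap i (𝓝[≠] x))) (𝓝 x) :=
      (tendsto_iff_comap.2 (hle x)).mono_right nhdsWithin_le_nhds
    have h2 : Tendsto i (Ultrafilter.of (comap i (𝓝[≠] y))) (𝓝 y) :=
      (tendsto_iff_comap.2 (hle y)).mono_right nhdsWithin_le_nhds
    have hxy' : Ultrafilter.of (comap i (𝓝[≠] x)) = Ultrafilter.of (comap i (𝓝[≠] y)) := hxy
    rw [hxy'] at h1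
    exact tendsto_nhds_unique h1 h2
  · refine (hle x).trans ?_
    rw [← hi.comap_cofinite_eq]
    exact comap_mono (nhdsNE_le_cofinite x)

theorem Ultrafilter.exists_tendsto {J K : Type*} [TopologicalSpace K] [CompactSpace K]
    (p : J → K) (F : Ultrafilter J) : ∃ x, Tendsto p F (𝓝 x) :=
  ⟨_, (F.map p).le_nhds_lim⟩

/-! ### Separated families in extremally disconnected spaces -/

section Separated

variable {J K : Type*} [TopologicalSpace K]

/-- A family of points that can be separated by pairwise disjoint open sets. -/
def IsSeparatedFamily (p : J → K) : Prop :=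
  ∃ O : J → Set K, (∀ j, p j ∈ O j) ∧ (∀ j, IsOpen (O j)) ∧ Pairwise (Disjoint on O)

theorem IsSeparatedFamily.injective {p : J → K} (hp : IsSeparatedFamily p) : Injective p := by
  obtain ⟨O, hpO, -, hd⟩ := hp
  exact fun i j hij => hd.eq (not_disjoint_iff.2 ⟨p i, hpO i, hij ▸ hpO j⟩)

theorem IsSeparatedFamily.comp {I : Type*} {p : J → K} (hp : IsSeparatedFamily p) {φ : I → J}
    (hφ : Injective φ) : IsSeparatedFamily (p ∘ φ) := by
  obtain ⟨O, hpO, hO, hd⟩ := hp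
  exact ⟨O ∘ φ, fun _ => hpO _, fun _ => hO _, fun i j hij => hd (hφ.ne hij)⟩

variable [ExtremallyDisconnected K]

/-- In an extremally disconnected space, a separated family has distinct limits along distinct
ultrafilters. -/
theorem IsSeparatedFamily.ultrafilter_eq {p : J → K} (hp : IsSeparatedFamily p)
    {F G : Ultrafilter J} {x : K} (hF : Tendsto p F (𝓝 x)) (hG : Tendsto p G (𝓝 x)) : F = G := by
  obtain ⟨O, hpO, hO, hd⟩ := hp
  have key : ∀ A : Set J, A ∈ F → A ∈ G := by
    intro A hA
    by_contra hAG
    rw [← Ultrafilter.compl_mem_iff_notMem] at hAG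
    have hdis : Disjoint (⋃ j ∈ A, O j) (⋃ j ∈ Aᶜ, O j) := by
      simp only [disjoint_iUnion_left, disjoint_iUnion_right]
      exact fun i hi j hj => hd fun h : j = i => hi (h ▸ hj)
    have hcl := ExtremallyDisconnected.disjoint_closure_of_disjoint_isOpen hdis
      (isOpen_biUnion fun j _ => hO j) (isOpen_biUnion fun j _ => hO j)
    refine disjoint_left.1 hcl (mem_closure_of_tendsto hF ?_) (mem_closure_of_tendsto hG ?_)
    · exact mem_of_superset hA fun j hj => mem_biUnion hj (hpO j)
    · exact mem_of_superset hAG fun j hj => mem_biUnion hj (hpO j)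
  exact (Ultrafilter.coe_le_coe.1 fun A hA => key A hA).symm

/-- `p j` is already the limit along the principal ultrafilter at `j`, so uniqueness would make `F`
principal. -/
theorem IsSeparatedFamily.notMem_range {p : J → K} (hp : IsSeparatedFamily p)
    {F : Ultrafilter J} (hF : (F : Filter J) ≤ cofinite) {x : K} (hx : Tendsto p F (𝓝 x)) :
    x ∉ range p := by
  rintro ⟨j, rfl⟩
  have h : F = pure j := hp.ultrafilter_eq hx (by
    rw [Ultrafilter.coe_pure]; exact tendsto_pure_nhds p j)
  subst h
  have := hF (finite_singleton j).compl_mem_cofinite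
  simp at this

theorem Ultrafilter.map_le_cofinite {I J : Type*} {φ : I → J} (hφ : Injective φ)
    {F : Ultrafilter I} (hF : (F : Filter I) ≤ cofinite) :
    ((F.map φ : Ultrafilter J) : Filter J) ≤ cofinite :=
  (map_mono hF).trans hφ.tendsto_cofinite

variable [CompactSpace K] {Z : Type*} [TopologicalSpace Z] [T2Space Z]

/-- Deleting a separated sequence, a continuous map that becomes injective has finite fibres on
that sequence. -/
theorem IsSeparatedFamily.finite_fiber {c : ℕ → K} (hc : IsSeparatedFamily c) {h : K → Z}
    (hh : Continuous h) (hinj : InjOn h (range c)ᶜ) (z : Z) : {n | h (c n) = z}.Finite := by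
  by_contra hinf
  let φ := Set.Infinite.natEmbedding _ hinf
  let ψ : ℕ → ℕ := fun n => φ n
  have hψ : Injective ψ := Subtype.val_injective.comp φ.injective
  obtain ⟨F, hFi, hF⟩ := exists_injective_real_freeUltrafilter
  -- Different free ultrafilters on an infinite fibre have different limits, all outside `range c`
  -- and all sent to `z`.
  have key : ∀ x, ∃ k, k ∉ range c ∧ Tendsto (c ∘ ψ) (F x) (𝓝 k) ∧ h k = z := by
    intro x
    obtain ⟨k, hk⟩ := (F x).exists_tendsto (c ∘ ψ)
    refine ⟨k, hc.notMem_range (Ultrafilter.map_le_cofinite hψ (hF x))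
      (by rwa [Ultrafilter.coe_map, tendsto_map'_iff]), hk, ?_⟩
    refine tendsto_nhds_unique ((hh.tendsto k).comp hk) ?_
    have : h ∘ c ∘ ψ = fun _ => z := funext fun n => (φ n).2
    rw [this]
    exact tendsto_const_nhds
  obtain ⟨k, hk, hk', hkz⟩ := key 0
  obtain ⟨l, hl, hl', hlz⟩ := key 1
  obtain rfl := hinj hk hl (hkz.trans hlz.symm)
  exact zero_ne_one (hFi ((hc.comp hψ).ultrafilter_eq hk' hl'))

/-- Otherwise infinitely many `c n` have partners `q` outside `range c` with the same image. Along
each free ultrafilter the two limits differ but share their image, so injectivity forces the limit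
of the `q`s into the countable `range c`. Uncountably many ultrafilters give distinct such limits.
-/
theorem IsSeparatedFamily.finite_mem_image [T2Space K] [CompactSpace Z] {c : ℕ → K}
    (hc : IsSeparatedFamily c) {h : K → Z} (hh : Continuous h) (hinj : InjOn h (range c)ᶜ) :
    {n | h (c n) ∈ h '' (range c)ᶜ}.Finite := by
  by_contra hinf
  have hS : ((fun n => h (c n)) '' {n | h (c n) ∈ h '' (range c)ᶜ}).Infinite := fun hfin =>
    hinf ((hfin.preimage' fun z _ => hc.finite_fiber hh hinj z).subset (subset_preimage_image _ _))
  obtain ⟨z, V, hzS, hzV, hV, hVd⟩ := hS.exists_seq_separated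
  choose n hn hnz using hzS
  choose q hq hqc using hn
  dsimp only at hnz hqc
  have hn : Injective n := fun i j hij => hVd.eq (not_disjoint_iff.2
    ⟨z i, hzV i, by rw [← hnz i, hij, hnz j]; exact hzV j⟩)
  have hne : ∀ k, c (n k) ≠ q k := fun k hk => hq k ⟨_, hk⟩
  choose A B hA hB hcA hqB hAB using fun k => t2_separation (hne k)
  have hp : IsSeparatedFamily (Sum.elim (fun k => c (n k)) q) := by
    refine ⟨Sum.elim (fun k => A k ∩ h ⁻¹' V k) (fun k => B k ∩ h ⁻¹' V k), ?_, ?_, ?_⟩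
    · rintro (k | k)
      · exact ⟨hcA k, by simp only [Sum.elim_inl, mem_preimage, hnz]; exact hzV k⟩
      · exact ⟨hqB k, by simp only [Sum.elim_inr, mem_preimage, hqc, hnz]; exact hzV k⟩
    · rintro (k | k)
      · exact (hA k).inter ((hV k).preimage hh)
      · exact (hB k).inter ((hV k).preimage hh)
    · have hVd' : ∀ i j, i ≠ j → Disjoint (h ⁻¹' V i) (h ⁻¹' V j) :=
        fun i j hij => (hVd hij).preimage h
      rintro (i | i) (j | j) hij
      · exact (hVd' i j (by simpa using hij)).mono inter_subset_right inter_subset_right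
      · by_cases e : i = j
        · subst e; exact (hAB i).mono inter_subset_left inter_subset_left
        · exact (hVd' i j e).mono inter_subset_right inter_subset_right
      · by_cases e : i = j
        · subst e; exact (hAB i).symm.mono inter_subset_left inter_subset_left
        · exact (hVd' i j e).mono inter_subset_right inter_subset_right
      · exact (hVd' i j (by simpa using hij)).mono inter_subset_right inter_subset_right
  obtain ⟨F, hFi, hF⟩ := exists_injective_real_freeUltrafilter
  choose a ha using fun x => (F x).exists_tendsto (fun k => c (n k))
  choose b hb using fun x => (F x).exists_tendsto q
  have ha' : ∀ x, a x ∉ range c := fun x =>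
    hc.notMem_range (Ultrafilter.map_le_cofinite hn (hF x))
      (by rw [Ultrafilter.coe_map, tendsto_map'_iff]; exact ha x)
  have hab : ∀ x, a x ≠ b x := by
    intro x hx
    have := hp.ultrafilter_eq (F := (F x).map Sum.inl) (G := (F x).map Sum.inr) (x := a x)
      (by rw [Ultrafilter.coe_map, tendsto_map'_iff]; exact ha x)
      (by rw [Ultrafilter.coe_map, tendsto_map'_iff, hx]; exact hb x)
    have h1 : range (Sum.inl : ℕ → ℕ ⊕ ℕ) ∈ (F x).map Sum.inl := by
      rw [Ultrafilter.mem_map, preimage_range]; exact univ_mem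
    rw [this, Ultrafilter.mem_map, preimage_inr_range_inl] at h1
    exact Ultrafilter.empty_notMem h1
  have hhab : ∀ x, h (a x) = h (b x) := by
    intro x
    refine tendsto_nhds_unique ((hh.tendsto _).comp (ha x)) ?_
    have : h ∘ (fun k => c (n k)) = h ∘ q := funext fun k => (hqc k).symm
    rw [this]
    exact (hh.tendsto _).comp (hb x)
  have hbc : ∀ x, b x ∈ range c := fun x => by
    by_contra hx
    exact hab x (hinj (ha' x) hx (hhab x))
  have hbi : Injective b := by
    intro x y hxy
    have hq : IsSeparatedFamily q := hp.comp Sum.inr_injective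
    exact hFi (hq.ultrafilter_eq (hb x) (hxy ▸ hb y))
  have : Countable (range c) := countable_range c
  have hcount : Countable ℝ :=
    Injective.countable (f := fun x => (⟨b x, hbc x⟩ : range c))
      fun x y hxy => hbi (congrArg Subtype.val hxy)
  exact not_countable hcount

end Separated

/-! ### Extending condensations, and the failure of subcompactness -/

/-- A continuous map from a dense subspace of an extremally disconnected compact Hausdorff space
to a compact Hausdorff space extends to the whole space. -/
theorem ExtremallyDisconnected.exists_extension {K Z : Type u} [TopologicalSpace K]
    [CompactSpace K] [T2Space K] [ExtremallyDisconnected K] [TopologicalSpace Z] [CompactSpace Z]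
    [T2Space Z] {S : Set K} (hS : Dense S) {g : S → Z} (hg : Continuous g) :
    ∃ h : K → Z, Continuous h ∧ ∀ x : S, h x = g x := by
  -- The closed graph projects onto `K`; projectivity of `K` gives a section, whose second
  -- coordinate is the extension.
  let Γ : Set (K × Z) := closure (range fun x : S => ((x : K), g x))
  have hΓ : CompactSpace Γ := isCompact_iff_compactSpace.1 isClosed_closure.isCompact
  let π : Γ → K := fun p => p.1.1
  have hπ : Continuous π := continuous_fst.comp continuous_subtype_val
  have hπs : Surjective π := by
    have hr : IsClosed (range π) := (isCompact_range hπ).isClosed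
    have hSr : S ⊆ range π := fun x hx =>
      ⟨⟨(x, g ⟨x, hx⟩), subset_closure ⟨⟨x, hx⟩, rfl⟩⟩, rfl⟩
    exact range_eq_univ.1 (hr.closure_eq ▸ (hS.mono hSr).closure_eq)
  obtain ⟨s, hs, hπ'⟩ := CompactT2.ExtremallyDisconnected.projective (A := K) continuous_id hπ hπs
  refine ⟨fun x => (s x).1.2, continuous_snd.comp (continuous_subtype_val.comp hs), fun x => ?_⟩
  have hx : (s x).1.1 = x := congrFun hπ' x
  obtain ⟨u, hu, hux⟩ := mem_closure_iff_ultrafilter.1 (s x).2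
  have h1 : Tendsto Prod.fst (u : Filter (K × Z)) (𝓝 (x : K)) := by
    rw [← hx]; exact (continuous_fst.tendsto _).mono_left hux
  have h2 : Tendsto Prod.snd (u : Filter (K × Z)) (𝓝 (s x).1.2) :=
    (continuous_snd.tendsto _).mono_left hux
  let v : Filter S := comap (fun x : S => ((x : K), g x)) u
  have hv : map (fun x : S => ((x : K), g x)) v = u := map_comap_of_mem hu
  have : v.NeBot := by rw [← map_neBot_iff (fun x : S => ((x : K), g x)), hv]; infer_instance
  rw [← hv, tendsto_map'_iff] at h1 h2
  have h3 : Tendsto id v (𝓝 x) := tendsto_subtype_rng.2 h1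
  exact tendsto_nhds_unique h2 ((hg.tendsto x).comp h3)

theorem IsSeparatedFamily.dense_compl_range {J K : Type*} [TopologicalSpace K] [T1Space K]
    (hK : ∀ x : K, ¬ IsOpen ({x} : Set K)) {p : J → K} (hp : IsSeparatedFamily p) :
    Dense (range p)ᶜ := by
  obtain ⟨O, hpO, hO, hd⟩ := hp
  rw [dense_iff_inter_open]
  rintro V hV ⟨x, hx⟩
  by_contra hne
  have hsub : ∀ y ∈ V, y ∈ range p := fun y hy => by
    by_contra h
    exact hne (nonempty_of_mem (x := y) (mem_inter hy h))
  obtain ⟨j, rfl⟩ := hsub x hx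
  refine hK (p j) ?_
  have : {p j} = V ∩ O j := by
    refine Subset.antisymm (singleton_subset_iff.2 ⟨hx, hpO j⟩) ?_
    rintro y ⟨hyV, hyO⟩
    obtain ⟨i, rfl⟩ := hsub y hyV
    obtain rfl : i = j := hd.eq (not_disjoint_iff.2 ⟨_, hpO i, hyO⟩)
    rfl
  rw [this]
  exact hV.inter (hO j)

theorem IsOpen.infinite_of_not_isOpen_singleton {K : Type*} [TopologicalSpace K] [T1Space K]
    (hK : ∀ x : K, ¬ IsOpen ({x} : Set K)) {V : Set K} (hV : IsOpen V) (hne : V.Nonempty) :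
    V.Infinite := by
  intro hfin
  obtain ⟨x, hx⟩ := hne
  refine hK x ?_
  have : {x} = V \ (V \ {x}) := by
    rw [sdiff_sdiff_right_self]
    exact (inter_eq_right.2 (singleton_subset_iff.2 hx)).symm
  rw [this]
  exact hV.sdiff (hfin.subset sdiff_subset).isClosed

/-- If a condensation of `D ⊕ K` onto `Y` is followed by a condensation of `Y` minus a separated
sequence of `K` onto a compact Hausdorff space, then infinitely many points of `D` are
available whose images cluster only at the closure of that sequence. -/
theorem IsSeparatedFamily.exists_infinite_clustering {D K Y Z : Type u}
    [TopologicalSpace K] [CompactSpace K] [T2Space K] [ExtremallyDisconnected K]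
    (hK : ∀ x : K, ¬ IsOpen ({x} : Set K))
    [TopologicalSpace Y] [TopologicalSpace Z] [CompactSpace Z] [T2Space Z]
    {a : D → Y} {b : K → Y} (hb : Continuous b) (ha : Injective a) (hbi : Injective b)
    (hab : ∀ d k, a d ≠ b k) (hsurj : ∀ y, (∃ d, a d = y) ∨ ∃ k, b k = y)
    {c : ℕ → K} (hc : IsSeparatedFamily c)
    {g : ((b '' range c)ᶜ : Set Y) → Z} (hg : IsCondensation g) :
    ∃ R : Set D, R.Infinite ∧ ∀ F : Ultrafilter D, (F : Filter D) ≤ cofinite → R ∈ F →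
      ∀ y, Tendsto a F (𝓝 y) → y ∈ b '' closure (range c) := by
  obtain ⟨hgc, hgi, hgs⟩ := hg
  have hbS : ∀ x : ((range c)ᶜ : Set K), b x ∈ (b '' range c)ᶜ := fun x hx =>
    x.2 ((hbi.mem_set_image).1 hx)
  have haS : ∀ d, a d ∈ (b '' range c)ᶜ := fun d ⟨k, _, hk⟩ => hab d k hk.symm
  obtain ⟨h, hh, hhg⟩ := ExtremallyDisconnected.exists_extension (hc.dense_compl_range hK)
    (g := fun x => g ⟨b x, hbS x⟩)
    (hgc.comp ((hb.comp continuous_subtype_val).subtype_mk _))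
  have hinj : InjOn h (range c)ᶜ := by
    intro x hx y hy hxy
    rw [hhg ⟨x, hx⟩, hhg ⟨y, hy⟩] at hxy
    exact hbi (congrArg Subtype.val (hgi hxy))
  have hfin := hc.finite_mem_image hh hinj
  have hout : ∀ n, h (c n) ∉ h '' (range c)ᶜ → ∃ d, g ⟨a d, haS d⟩ = h (c n) := by
    intro n hn
    obtain ⟨⟨y, hy⟩, hyz⟩ := hgs (h (c n))
    obtain ⟨d, rfl⟩ | ⟨k, rfl⟩ := hsurj y
    · exact ⟨d, hyz⟩
    · have hk : k ∈ (range c)ᶜ := fun hk => hy (mem_image_of_mem b hk)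
      exact absurd ⟨k, hk, (hhg ⟨k, hk⟩).trans hyz⟩ hn
  refine ⟨{d | ∃ n, g ⟨a d, haS d⟩ = h (c n)}, ?_, ?_⟩
  · intro hR
    have h1 : ((fun d => g ⟨a d, haS d⟩) '' {d | ∃ n, g ⟨a d, haS d⟩ = h (c n)}).Finite :=
      hR.image _
    have h2 := h1.preimage' (f := fun n => h (c n)) fun z _ => hc.finite_fiber hh hinj z
    refine (infinite_univ (α := ℕ)) ((hfin.union h2).subset fun n _ => ?_)
    by_cases hn : h (c n) ∈ h '' (range c)ᶜ
    · exact Or.inl hn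
    · obtain ⟨d, hd⟩ := hout n hn
      exact Or.inr ⟨d, ⟨n, hd⟩, hd⟩
  · intro F hF hRF y hy
    by_cases hyC : y ∈ b '' range c
    · exact image_mono subset_closure hyC
    choose! s hs using fun (d : D) (hd : ∃ n, g ⟨a d, haS d⟩ = h (c n)) => hd
    have hsinj : InjOn s {d | ∃ n, g ⟨a d, haS d⟩ = h (c n)} := by
      intro d hd e he hde
      have : g ⟨a d, haS d⟩ = g ⟨a e, haS e⟩ := by rw [hs d hd, hs e he, hde]
      exact ha (congrArg Subtype.val (hgi this))
    -- `s` is injective on the infinite set and `F` is free, so the pushforward is free and the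
    -- limit `k` of `c ∘ s` is an undeleted point.
    have hsF : ((F.map s : Ultrafilter ℕ) : Filter ℕ) ≤ cofinite := by
      rw [le_cofinite_iff_compl_singleton_mem]
      intro n
      by_contra hn
      have hn' : s ⁻¹' {n} ∈ F := by
        have := Ultrafilter.compl_notMem_iff.1 hn
        exact this
      have hsub : (s ⁻¹' {n} ∩ {d | ∃ n, g ⟨a d, haS d⟩ = h (c n)}).Subsingleton :=
        fun d hd e he => hsinj hd.2 he.2 (hd.1.trans he.1.symm)
      have h1 := inter_mem hn' hRF
      have h2 := hF hsub.finite.compl_mem_cofinite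
      exact Ultrafilter.compl_notMem_iff.2 h1 h2
    obtain ⟨k, hk⟩ := F.exists_tendsto (c ∘ s)
    have hkc : k ∉ range c := hc.notMem_range hsF
      (by rwa [Ultrafilter.coe_map, tendsto_map'_iff])
    have h1 : Tendsto (fun d => g ⟨a d, haS d⟩) F (𝓝 (g ⟨y, hyC⟩)) :=
      (hgc.tendsto _).comp (tendsto_subtype_rng.2 hy)
    have h2 : Tendsto (fun d => g ⟨a d, haS d⟩) F (𝓝 (h k)) :=
      ((hh.tendsto k).comp hk).congr' (mem_of_superset hRF fun d hd => (hs d hd).symm)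
    have h3 : g ⟨y, hyC⟩ = g ⟨b k, hbS ⟨k, hkc⟩⟩ :=
      (tendsto_nhds_unique h1 h2).trans (hhg ⟨k, hkc⟩)
    exact ⟨k, mem_closure_of_tendsto hk (Eventually.of_forall fun d => mem_range_self _),
      (congrArg Subtype.val (hgi h3)).symm⟩

theorem not_isATauSubcompact_sum {τ : Cardinal.{u}} (hτ : ℵ₀ ≤ τ) {D K E : Type u}
    [TopologicalSpace D] [TopologicalSpace K] [CompactSpace K] [T2Space K]
    [ExtremallyDisconnected K] (hK : ∀ x : K, ¬ IsOpen ({x} : Set K))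
    {V : E → Set K} (hV : ∀ e, IsOpen (V e)) (hVne : ∀ e, (V e).Nonempty)
    (hVd : Pairwise (Disjoint on V)) (hDE : (2 : Cardinal.{u}) ^ #D < #E) :
    ¬ IsATauSubcompact τ (D ⊕ K) := by
  intro hsub
  obtain ⟨Y, _, f, ⟨hYc, hY2, hYτ⟩, hfc, hfi, hfs⟩ := hsub ∅ (by simp)
  have hm : ∀ x : D ⊕ K, x ∈ (∅ᶜ : Set (D ⊕ K)) := fun x => by simp
  let a : D → Y := fun d => f ⟨Sum.inl d, hm _⟩
  let b : K → Y := fun k => f ⟨Sum.inr k, hm _⟩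
  have hb : Continuous b := hfc.comp (continuous_inr.subtype_mk _)
  have hai : Injective a := fun d e h => Sum.inl_injective (congrArg Subtype.val (hfi h))
  have hbi : Injective b := fun d e h => Sum.inr_injective (congrArg Subtype.val (hfi h))
  have hab : ∀ d k, a d ≠ b k := fun d k h => by
    have := congrArg Subtype.val (hfi h)
    exact Sum.inl_ne_inr this
  have hsurj : ∀ y, (∃ d, a d = y) ∨ ∃ k, b k = y := by
    intro y
    obtain ⟨⟨d | k, hx⟩, rfl⟩ := hfs y
    · exact Or.inl ⟨d, rfl⟩
    · exact Or.inr ⟨k, rfl⟩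
  have key : ∀ e, ∃ R : Set D, R.Infinite ∧ ∀ F : Ultrafilter D, (F : Filter D) ≤ cofinite →
      R ∈ F → ∀ y, Tendsto a F (𝓝 y) → y ∈ b '' closure (V e) := by
    intro e
    obtain ⟨c, U, hcV, hcU, hU, hUd⟩ :=
      ((hV e).infinite_of_not_isOpen_singleton hK (hVne e)).exists_seq_separated
    have hc : IsSeparatedFamily c := ⟨U, hcU, hU, hUd⟩
    obtain ⟨Z, _, _, _, g, hg⟩ := hYτ (b '' range c)
      ((((countable_range c).image b).le_aleph0).trans hτ)
    obtain ⟨R, hR, hRF⟩ := hc.exists_infinite_clustering hK hb hai hbi hab hsurj hg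
    exact ⟨R, hR, fun F hF hRm y hy => image_mono (closure_mono (range_subset_iff.2 hcV))
      (hRF F hF hRm y hy)⟩
  choose R hR hRF using key
  -- `D` has only `2 ^ #D` subsets, so two indices share one; a free ultrafilter on it has a limit
  -- in both disjoint closures.
  have hRi : ¬ Injective R := fun h => by
    have := mk_le_of_injective h
    rw [mk_set] at this
    exact this.not_gt hDE
  obtain ⟨e, e', hee, hne⟩ : ∃ e e', R e = R e' ∧ e ≠ e' := by
    simpa [Injective] using hRi
  have := cofinite_inf_principal_neBot_iff.2 (hR e)
  obtain ⟨F, hF⟩ := Ultrafilter.exists_le (cofinite ⊓ 𝓟 (R e))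
  obtain ⟨hF1, hF2⟩ := le_inf_iff.1 hF
  have hF2 : R e ∈ F := le_principal_iff.1 hF2
  obtain ⟨y, hy⟩ := F.exists_tendsto a
  obtain ⟨k, hk, rfl⟩ := hRF e F hF1 hF2 y hy
  obtain ⟨k', hk', hkk⟩ := hRF e' F hF1 (hee ▸ hF2) _ hy
  rw [hbi hkk] at hk'
  exact disjoint_left.1 (ExtremallyDisconnected.disjoint_closure_of_disjoint_isOpen (hVd hne)
    (hV e) (hV e')) hk hk'

/-! ### Almost strict subcompactness of the sum -/

theorem isAlmostStrictlyATauSubcompact_sum {τ : Cardinal.{u}} {D K : Type u}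
    (hτ : ℵ₀ ≤ τ) (hD : τ < #D) [TopologicalSpace D] [DiscreteTopology D] [TopologicalSpace K]
    [CompactSpace K] [T2Space K] [Nonempty K] :
    IsAlmostStrictlyATauSubcompact τ (D ⊕ K) := by
  classical
  intro C hC
  obtain ⟨k₀⟩ := ‹Nonempty K›
  let A : Set D := Sum.inl ⁻¹' C
  let B : Set K := Sum.inr ⁻¹' C
  have hA : #A ≤ τ := (mk_preimage_of_injective _ _ Sum.inl_injective).trans hC
  have hB : #B ≤ τ := (mk_preimage_of_injective _ _ Sum.inr_injective).trans hC
  have hBA : #B ≤ #(Aᶜ : Set D) := by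
    by_contra hlt
    have h1 : #(Aᶜ : Set D) ≤ τ := (not_le.1 hlt).le.trans hB
    have h2 : #D ≤ τ + τ := by
      rw [← mk_sum_compl A]
      exact add_le_add hA h1
    rw [add_eq_self hτ] at h2
    exact h2.not_gt hD
  obtain ⟨j⟩ := hBA
  -- the points of `D` outside `C` that do not replace deleted points of `K`
  let T : Set D := {d | d ∉ A ∧ ∀ k, (j k : D) ≠ d}
  -- `j k` stands in for the deleted point `k`, points of `T` become isolated points converging to
  -- `(k₀, ∞)`, and deleted points of `D` go to `(k₀, ∞)`. Points of `K` keep their place even when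
  -- deleted, which gives the continuous extension.
  let φ : D ⊕ K → K × OnePoint D := Sum.elim
    (fun d => if h : ∃ k, (j k : D) = d then ((h.choose : K), OnePoint.infty)
      else if d ∈ A then (k₀, OnePoint.infty) else (k₀, (d : OnePoint D)))
    (fun k => (k, OnePoint.infty))
  have hφK : ∀ k, φ (Sum.inr k) = (k, OnePoint.infty) := fun k => rfl
  have hφj : ∀ k, φ (Sum.inl (j k : D)) = ((k : K), OnePoint.infty) := by
    intro k
    have h : ∃ k', (j k' : D) = j k := ⟨k, rfl⟩
    have hc : h.choose = k := j.injective (Subtype.ext h.choose_spec)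
    simp only [φ, Sum.elim_inl, dif_pos h, hc]
  have hφT : ∀ d ∈ T, φ (Sum.inl d) = (k₀, (d : OnePoint D)) := by
    intro d hd
    have h : ¬ ∃ k, (j k : D) = d := fun ⟨k, hk⟩ => hd.2 k hk
    simp only [φ, Sum.elim_inl, dif_neg h, if_neg hd.1]
  have hφA : ∀ d ∈ A, φ (Sum.inl d) = (k₀, OnePoint.infty) := by
    intro d hd
    have h : ¬ ∃ k, (j k : D) = d := fun ⟨k, hk⟩ => (j k).2 (hk ▸ hd)
    simp only [φ, Sum.elim_inl, dif_neg h, if_pos hd]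
  have hcases : ∀ d, d ∈ A ∨ (∃ k, (j k : D) = d) ∨ d ∈ T := by
    intro d
    by_cases h1 : d ∈ A
    · exact Or.inl h1
    by_cases h2 : ∃ k, (j k : D) = d
    · exact Or.inr (Or.inl h2)
    · exact Or.inr (Or.inr ⟨h1, fun k hk => h2 ⟨k, hk⟩⟩)
  let Y : Set (K × OnePoint D) := Set.univ ×ˢ {OnePoint.infty} ∪
    {k₀} ×ˢ (((↑) : D → OnePoint D) '' Tᶜ)ᶜ
  have hYcl : IsClosed Y := by
    refine (isClosed_univ.prod isClosed_singleton).union (isClosed_singleton.prod ?_)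
    rw [isClosed_compl_iff, OnePoint.isOpen_image_coe]
    exact isOpen_discrete _
  have hYinf : ∀ k, (k, OnePoint.infty) ∈ Y := fun k => Or.inl ⟨mem_univ _, rfl⟩
  have hYT : ∀ d, (k₀, ((d : D) : OnePoint D)) ∈ Y ↔ d ∈ T := by
    intro d
    simp [Y]
  have hφY : ∀ x, φ x ∈ Y := by
    rintro (d | k)
    · obtain h | ⟨k, rfl⟩ | h := hcases d
      · rw [hφA d h]; exact hYinf _
      · rw [hφj]; exact hYinf _
      · rw [hφT d h]; exact (hYT d).2 h
    · exact hYinf _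
  have hφc : Continuous φ := continuous_sum_dom.2
    ⟨continuous_of_discreteTopology, continuous_id.prodMk continuous_const⟩
  let g : D ⊕ K → Y := fun x => ⟨φ x, hφY x⟩
  have hg : Continuous g := hφc.subtype_mk _
  refine ⟨Y, inferInstance, isCompact_iff_compactSpace.1 hYcl.isCompact, inferInstance,
    fun x => g x, ⟨hg.comp continuous_subtype_val, ?_, ?_⟩, g, hg, fun _ => rfl⟩
  · rintro ⟨x, hx⟩ ⟨y, hy⟩ hxy
    have hxy : φ x = φ y := congrArg Subtype.val hxy
    refine Subtype.ext ?_
    change x = y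
    rcases x with d | k <;> rcases y with e | l
    · obtain h | ⟨k, rfl⟩ | h := hcases d
      · exact absurd h hx
      · obtain h' | ⟨l, rfl⟩ | h' := hcases e
        · exact absurd h' hy
        · rw [hφj, hφj] at hxy
          rw [Subtype.ext (congrArg Prod.fst hxy)]
        · rw [hφj, hφT e h'] at hxy
          exact absurd (congrArg Prod.snd hxy) (OnePoint.infty_ne_coe e)
      · obtain h' | ⟨l, rfl⟩ | h' := hcases e
        · exact absurd h' hy
        · rw [hφj, hφT d h] at hxy
          exact absurd (congrArg Prod.snd hxy) (OnePoint.coe_ne_infty d)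
        · rw [hφT d h, hφT e h'] at hxy
          rw [OnePoint.coe_injective (congrArg Prod.snd hxy)]
    · obtain h | ⟨k, rfl⟩ | h := hcases d
      · exact absurd h hx
      · rw [hφj, hφK] at hxy
        have : (k : K) = l := congrArg Prod.fst hxy
        exact absurd k.2 (this ▸ hy)
      · rw [hφT d h, hφK] at hxy
        exact absurd (congrArg Prod.snd hxy) (OnePoint.coe_ne_infty d)
    · obtain h | ⟨l, rfl⟩ | h := hcases e
      · exact absurd h hy
      · rw [hφj, hφK] at hxy
        have : k = (l : K) := congrArg Prod.fst hxy
        exact absurd l.2 (this ▸ hx)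
      · rw [hφT e h, hφK] at hxy
        exact absurd (congrArg Prod.snd hxy) (OnePoint.infty_ne_coe e)
    · rw [hφK, hφK] at hxy
      exact congrArg Sum.inr (congrArg Prod.fst hxy)
  · rintro ⟨⟨k, t⟩, hy⟩
    induction t using OnePoint.rec with
    | infty =>
      by_cases hk : Sum.inr k ∈ C
      · exact ⟨⟨Sum.inl (j ⟨k, hk⟩ : D), (j ⟨k, hk⟩).2⟩, Subtype.ext (hφj ⟨k, hk⟩)⟩
      · exact ⟨⟨Sum.inr k, hk⟩, rfl⟩
    | coe d =>
      obtain rfl : k = k₀ := by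
        obtain ⟨-, h⟩ | ⟨h, -⟩ := hy
        · exact absurd h (OnePoint.coe_ne_infty d)
        · exact h
      have hd : d ∈ T := (hYT d).1 hy
      exact ⟨⟨Sum.inl d, hd.1⟩, Subtype.ext (hφT d hd)⟩

/-! ### Gleason covers and the construction of `K` -/

/-- Gleason cover: every compact Hausdorff space is the image of an extremally disconnected compact
Hausdorff space under a continuous surjection that is irreducible, that is, maps no proper closed
subset onto the whole space. -/
theorem exists_extremallyDisconnected_irreducible_cover (A : Type u) [TopologicalSpace A]
    [CompactSpace A] [T2Space A] :
    ∃ (K : Type u) (_ : TopologicalSpace K) (_ : CompactSpace K) (_ : T2Space K)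
      (_ : ExtremallyDisconnected K) (π : K → A), Continuous π ∧ Surjective π ∧
      ∀ S : Set K, IsClosed S → π '' S = Set.univ → S = Set.univ := by
  obtain ⟨A', ⟨e⟩⟩ : ∃ A' : Type u, Nonempty (A' ≃ A) := ⟨A, ⟨Equiv.refl A⟩⟩
  let _ : TopologicalSpace A' := ⊥
  have : DiscreteTopology A' := ⟨rfl⟩
  have hid : Continuous e := continuous_of_discreteTopology
  let ρ : StoneCech A' → A := stoneCechExtend hid
  have hρ : Continuous ρ := continuous_stoneCechExtend hid
  have hρs : Surjective ρ := fun a =>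
    ⟨stoneCechUnit (e.symm a),
      (congrFun (stoneCechExtend_extends hid) _).trans (e.apply_symm_apply a)⟩
  obtain ⟨E, hE, hEs, hEmin⟩ := exists_compact_surjective_zorn_subset hρ hρs
  let π : E → A := E.domRestrict ρ
  have hπ : Continuous π := hρ.comp continuous_subtype_val
  have hπs : Surjective π := fun a => by
    obtain ⟨x, hx, rfl⟩ := hEs.symm ▸ mem_univ a
    exact ⟨⟨x, hx⟩, rfl⟩
  have hmin : ∀ S : Set E, IsClosed S → π '' S = Set.univ → S = Set.univ := fun S hS h => by
    by_contra hne
    exact hEmin S hne hS h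
  obtain ⟨r, hr, hπr⟩ := StoneCech.projective (X := A') hρ hπ hπs
  -- If `r` moved `e`, a neighbourhood `W` of `e` would be sent off itself by `r`, which preserves
  -- fibres over `A`; then `Wᶜ` would still map onto `A`, against minimality. So `E` is a retract of
  -- `StoneCech A'` and inherits projectivity.
  have hrE : ∀ e : E, r e = e := by
    intro e
    by_contra hne
    obtain ⟨G, G', hG, hG', heG, heG', hd⟩ := t2_separation hne
    let W : Set E := G' ∩ (fun x : E => r x) ⁻¹' G
    have hW : IsOpen W := hG'.inter (hG.preimage (hr.comp continuous_subtype_val))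
    have heW : e ∈ W := ⟨heG', heG⟩
    refine absurd (hmin Wᶜ hW.isClosed_compl (eq_univ_of_forall fun a => ?_))
      fun h => (h.symm ▸ mem_univ e : e ∈ Wᶜ) heW
    obtain ⟨x, rfl⟩ := hπs a
    by_cases hx : x ∈ W
    · refine ⟨r x, fun h => disjoint_left.1 hd hx.2 h.1, ?_⟩
      exact congrFun hπr x
    · exact ⟨x, hx, rfl⟩
  have hproj : CompactT2.Projective E := by
    intro Y Z _ _ _ _ _ _ f g hf hg hgs
    obtain ⟨h, hh, hgh⟩ := StoneCech.projective (X := A') (hf.comp hr) hg hgs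
    refine ⟨fun e => h e, hh.comp continuous_subtype_val, funext fun e => ?_⟩
    have := congrFun hgh e
    simp only [comp_apply, hrE] at this
    exact this
  exact ⟨E, inferInstance, hE, inferInstance, hproj.extremallyDisconnected, π, hπ, hπs, hmin⟩

/-- The Gleason cover of `OnePoint E × (ℕ → Bool)` works: preimages of the slices over the isolated
points of `OnePoint E` are the disjoint open sets, and the Cantor factor excludes isolated points,
which irreducibility would push down to the base. -/
theorem exists_extremallyDisconnected_cellular (E : Type u) :
    ∃ (K : Type u) (_ : TopologicalSpace K) (_ : CompactSpace K) (_ : T2Space K)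
      (_ : ExtremallyDisconnected K), Nonempty K ∧ (∀ x : K, ¬ IsOpen ({x} : Set K)) ∧
      ∃ V : E → Set K, (∀ e, IsOpen (V e)) ∧ (∀ e, (V e).Nonempty) ∧
        Pairwise (Disjoint on V) := by
  let _ : TopologicalSpace E := ⊥
  have : DiscreteTopology E := ⟨rfl⟩
  obtain ⟨K, _, _, _, _, π, hπ, hπs, hmin⟩ :=
    exists_extremallyDisconnected_irreducible_cover (OnePoint E × (ℕ → Bool))
  have hA : ∀ a : OnePoint E × (ℕ → Bool), ¬ IsOpen ({a} : Set (OnePoint E × (ℕ → Bool))) := by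
    intro a ha
    have h1 : IsOpen ({a.2} : Set (ℕ → Bool)) := by
      convert ha.preimage (f := fun x : ℕ → Bool => (a.1, x)) (by fun_prop) using 1
      ext x
      simp [Prod.ext_iff]
    have h2 : Tendsto (fun n => update a.2 n (!a.2 n)) atTop (𝓝 a.2) := by
      rw [tendsto_pi_nhds]
      intro i
      refine tendsto_const_nhds.congr' ?_
      filter_upwards [eventually_gt_atTop i] with n hn
      rw [update_of_ne hn.ne]
    obtain ⟨n, hn⟩ := (h2.eventually_mem (h1.mem_nhds rfl)).exists
    have := congrFun hn n
    simp at this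
  refine ⟨K, inferInstance, inferInstance, inferInstance, inferInstance,
    ⟨(hπs (OnePoint.infty, fun _ => false)).choose⟩, fun x hx => ?_,
    fun e => π ⁻¹' (Prod.fst ⁻¹' {(e : OnePoint E)}), fun e => ?_, fun e => ?_, ?_⟩
  · have hne : π '' {x}ᶜ ≠ Set.univ := fun h => by
      have := hmin _ hx.isClosed_compl h
      exact (this.symm ▸ mem_univ x : x ∈ ({x}ᶜ : Set K)) rfl
    have hcl : IsClosed (π '' {x}ᶜ) := (hx.isClosed_compl.isCompact.image hπ).isClosed
    obtain ⟨a, ha⟩ := (ne_univ_iff_exists_notMem _).1 hne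
    refine hA a ?_
    have : {a} = (π '' {x}ᶜ)ᶜ := by
      refine (singleton_subset_iff.2 ha).antisymm fun b hb => ?_
      have hfib : ∀ b ∉ π '' {x}ᶜ, b = π x := fun b hb => by
        obtain ⟨y, rfl⟩ := hπs b
        by_contra hy
        exact hb ⟨y, fun h => hy (congrArg π h), rfl⟩
      exact (hfib b hb).trans (hfib a ha).symm
    rw [this]
    exact hcl.isOpen_compl
  · refine IsOpen.preimage hπ (IsOpen.preimage continuous_fst ?_)
    rw [← image_singleton, OnePoint.isOpen_image_coe]
    exact isOpen_discrete _
  · obtain ⟨x, hx⟩ := hπs ((e : OnePoint E), fun _ => false)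
    exact ⟨x, by simp [hx]⟩
  · intro e e' hne
    refine disjoint_left.2 fun x hx hx' => hne (OnePoint.coe_injective ?_)
    exact (mem_singleton_iff.1 hx).symm.trans hx'

theorem theorem1p5 (τ : Cardinal.{u}) (hτ : ℵ₀ ≤ τ) :
    ∃ (D : Type u) (_ : TopologicalSpace D) (_ : DiscreteTopology D)
      (K : Type u) (_ : TopologicalSpace K) (_ : CompactSpace K) (_ : T2Space K)
      (_ : ExtremallyDisconnected K),
      #D = Order.succ τ ∧
      (∀ x : K, ¬ IsOpen ({x} : Set K)) ∧
      (2 : Cardinal.{u}) ^ ((2 : Cardinal.{u}) ^ Order.succ τ) < #K ∧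
      T2Space (D ⊕ K) ∧
      IsAlmostStrictlyATauSubcompact τ (D ⊕ K) ∧
      ¬ IsATauSubcompact τ (D ⊕ K) := by
  let D : Type u := (Order.succ τ).out
  -- Three power sets serve the bound on `#K`; the counting argument needs only `2 ^ #D < #E`.
  let E : Type u := Set (Set (Set D))
  have hD : #D = Order.succ τ := mk_out _
  let _ : TopologicalSpace D := ⊥
  have : DiscreteTopology D := ⟨rfl⟩
  obtain ⟨K, _, _, _, _, hne, hK, V, hV, hVne, hVd⟩ := exists_extremallyDisconnected_cellular E
  have hEK : #E ≤ #K := by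
    choose v hv using hVne
    refine mk_le_of_injective (f := v) fun e e' h => hVd.eq ?_
    exact not_disjoint_iff.2 ⟨v e, hv e, h ▸ hv e'⟩
  have hE : (2 : Cardinal.{u}) ^ ((2 : Cardinal.{u}) ^ #D) < #E := by
    simp only [E, mk_set]
    exact cantor _
  refine ⟨D, inferInstance, inferInstance, K, inferInstance, inferInstance, inferInstance,
    inferInstance, hD, hK, hD ▸ hE.trans_le hEK, inferInstance, ?_, ?_⟩
  · exact isAlmostStrictlyATauSubcompact_sum hτ (hD ▸ Order.lt_succ τ)
  · exact not_isATauSubcompact_sum hτ hK hV hVne hVd ((cantor _).trans hE)
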